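/- Conventions. Let $R$ be a compact Hausdorff topological ring and let $r\in R$ be an element such that $x\mapsto rx$ is an injective, continuous and open map $R\to R$. Let $\alpha_r$ be the endomorphism of $C(R)$ (complex-valued continuous functions) given by $$(\alpha_r f)(x)=\begin{cases} f(x/r) & \text{if } r\mid x,\\ 0 & \text{otherwise.}\end{cases}$$ The crossed product by endomorphism $C(R)\rtimes_{\alpha_r}\mathbb N$ is the universal unital C$^*$-algebra generated by elements $M_f$ ($f\in C(R)$), where $f\mapsto M_f$ is a unital $*$-homomorphism, and an element $V$, subject to the relations $$V^*V=I,\qquad V M_f V^*=M_{\alpha_r(f)}\quad (f\in C(R)).$$ For a prime $p$ and a nonzero $p$-adic integer $r\in\mathbb Z_p$, put $A_r=C(\mathbb Z_p)\rtimes_{\alpha_r}\mathbb N$. For an integer $s>1$, let $\mathbb Z_s=\varprojlim_n \mathbb Z/s^n\mathbb Z$ with its inverse limit topology, and let the Hensel–Steinitz algebra be $HS(s)=C(\mathbb Z_s)\rtimes_{\alpha_s}\mathbb N$. (Multiplication by $r\ne 0$ on $\mathbb Z_p$ and by $s$ on $\mathbb Z_s$ is injective, continuous and open.) Statement. Let $p$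 be a prime, let $N>0$ be an integer, and let $r\in\mathbb Z_p$ satisfy $|r|_p=p^{-N}$ (equivalently, $r=r'p^N$ with $|r'|_p=1$). Then $A_r$ and $HS(p^N)$ are isomorphic as C$^*$-algebras: $$A_r\cong HS(p^N).$$ -/

import Mathlib

open scoped ENNReal Topology

noncomputable section

universe u v

/-! ### Crossed products by endomorphisms -/

/-- A covariant pair `(M, V)` for an endomorphism `α` of a unital C⋆-algebra `B`, in a unital
C⋆-algebra `A`: a unital ⋆-homomorphism `M : B → A` and an isometry `V` with
`V M_b V⋆ = M_{α b}`.  The endomorphism `α` itself need not be unital. -/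
structure CovariantPair {B : Type u} [CStarAlgebra B] (α : B →⋆ₙₐ[ℂ] B)
    (A : Type v) [CStarAlgebra A] where
  M : B →⋆ₐ[ℂ] A
  V : A
  star_mul_self : star V * V = 1
  covariant : ∀ b : B, V * M b * star V = M (α b)

/-- A nonzero unital C⋆-algebra together with a covariant pair in it. -/
structure CovariantSystem {B : Type u} [CStarAlgebra B] (α : B →⋆ₙₐ[ℂ] B) where
  carrier : Type u
  [cstar : CStarAlgebra carrier]
  [nontrivial : Nontrivial carrier]
  pair : CovariantPair α carrier

attribute [instance] CovariantSystem.cstar CovariantSystem.nontrivial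

/-- The `ℓ^∞`-product of unital C⋆-algebras is a unital C⋆-algebra. -/
instance lpInftyCStarAlgebra {I : Type*} {A : I → Type*} [∀ i, CStarAlgebra (A i)]
    [∀ i, Nontrivial (A i)] : CStarAlgebra (lp A ∞) where

namespace CrossedProduct

variable {B : Type u} [CStarAlgebra B] (α : B →⋆ₙₐ[ℂ] B)

/-- The `ℓ^∞`-product of all the C⋆-algebras carrying a covariant pair. -/
abbrev Ambient : Type (u + 1) :=
  lp (fun i : CovariantSystem α => i.carrier) ∞

/-- The tuple of all isometries of covariant pairs. -/
def ambientV : Ambient α :=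
  ⟨fun i => i.pair.V, memℓp_infty ⟨1, by
    rintro _ ⟨i, rfl⟩
    have h := CStarRing.norm_star_mul_self (x := i.pair.V)
    rw [i.pair.star_mul_self, norm_one] at h
    nlinarith [norm_nonneg i.pair.V]⟩⟩

/-- The tuple of the values at `b` of all homomorphisms of covariant pairs. -/
def ambientM (b : B) : Ambient α :=
  ⟨fun i => i.pair.M b, memℓp_infty ⟨‖b‖, by
    rintro _ ⟨i, rfl⟩
    exact NonUnitalStarAlgHom.norm_apply_le i.pair.M b⟩⟩

/-- The closed unital ⋆-subalgebra generated by the tuples `M_b` and `V`. -/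
def subalgebra : StarSubalgebra ℂ (Ambient α) :=
  (StarAlgebra.adjoin ℂ (insert (ambientV α) (Set.range (ambientM α)))).topologicalClosure

end CrossedProduct

/-- The crossed product `B ⋊_α ℕ` of a unital C⋆-algebra `B` by an endomorphism `α`: the universal
unital C⋆-algebra generated by elements `M_b` (`b ∈ B`) depending ⋆-homomorphically on `b`, and by
an isometry `V` with `V M_b V⋆ = M_{α b}`.  It is the completion of the polynomials in these
generators for the supremum of the norms in all covariant pairs; its universal property is
`CrossedProduct.existsUnique_lift`. -/
def CrossedProduct {B : Type u} [CStarAlgebra B] (α : B →⋆ₙₐ[ℂ] B) : Type (u + 1) :=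
  CrossedProduct.subalgebra α

namespace CrossedProduct

variable {B : Type u} [CStarAlgebra B] (α : B →⋆ₙₐ[ℂ] B)

instance : CStarAlgebra (CrossedProduct α) :=
  StarSubalgebra.cstarAlgebra (subalgebra α)
    (h_closed := StarSubalgebra.isClosed_topologicalClosure _)

theorem ambientV_mem : ambientV α ∈ subalgebra α :=
  StarSubalgebra.le_topologicalClosure _ (StarAlgebra.subset_adjoin ℂ _ (Set.mem_insert _ _))

theorem ambientM_mem (b : B) : ambientM α b ∈ subalgebra α :=
  StarSubalgebra.le_topologicalClosure _
    (StarAlgebra.subset_adjoin ℂ _ (Set.mem_insert_of_mem _ ⟨b, rfl⟩))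

/-- The generators `M_b` and `V` of the crossed product. -/
def universalPair : CovariantPair α (CrossedProduct α) where
  M :=
    { toFun := fun b => ⟨ambientM α b, ambientM_mem α b⟩
      map_one' := Subtype.ext (lp.ext (funext fun i => map_one i.pair.M))
      map_mul' := fun x y => Subtype.ext (lp.ext (funext fun i => map_mul i.pair.M x y))
      map_zero' := Subtype.ext (lp.ext (funext fun i => map_zero i.pair.M))
      map_add' := fun x y => Subtype.ext (lp.ext (funext fun i => map_add i.pair.M x y))
      commutes' := fun c => Subtype.ext (lp.ext (funext fun i => AlgHomClass.commutes i.pair.M c))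
      map_star' := fun x => Subtype.ext (lp.ext (funext fun i => map_star i.pair.M x)) }
  V := ⟨ambientV α, ambientV_mem α⟩
  star_mul_self := Subtype.ext (lp.ext (funext fun i => i.pair.star_mul_self))
  covariant := fun b => Subtype.ext (lp.ext (funext fun i => i.pair.covariant b))

/-- The coordinate projection of the crossed product to a covariant system. -/
def proj (i : CovariantSystem α) : CrossedProduct α →⋆ₐ[ℂ] i.carrier where
  toFun := fun x => (x.1 : ∀ i : CovariantSystem α, i.carrier) i
  map_one' := rfl
  map_mul' := fun _ _ => rfl
  map_zero' := rfl
  map_add' := fun _ _ => rfl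
  commutes' := fun _ => rfl
  map_star' := fun _ => rfl

/-- A C⋆-algebra structure on a small model of a C⋆-algebra. -/
abbrev shrinkCStarAlgebra (D : Type v) [CStarAlgebra D] [Small.{u} D] :
    CStarAlgebra (Shrink.{u} D) :=
  let e := Shrink.algEquiv ℂ D
  letI : NormedRing (Shrink.{u} D) :=
    NormedRing.induced (Shrink.{u} D) D e e.injective
  letI : NormedAlgebra ℂ (Shrink.{u} D) := NormedAlgebra.induced ℂ (Shrink.{u} D) D e
  letI : StarRing (Shrink.{u} D) :=
    { star := fun x => e.symm (star (e x))
      star_involutive := fun x => by simp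
      star_mul := fun x y => by simp
      star_add := fun x y => by simp }
  { complete := by
      have hi : Isometry e := AddMonoidHomClass.isometry_of_norm e fun _ => rfl
      have : CompleteSpace (Shrink.{u} D) :=
        (completeSpace_congr (e := e.toEquiv) hi.isUniformEmbedding).2 inferInstance
      exact fun {f} hf => this.complete hf
    norm_mul_self_le := fun x => by
      change ‖e x‖ * ‖e x‖ ≤ ‖e (e.symm (star (e x)) * x)‖
      simp [CStarRing.norm_star_mul_self]
    star_smul := fun c x => by
      change e.symm (star (e (c • x))) = star c • e.symm (star (e x))
      simp }

/-- The subalgebra generated by a covariant pair is small. -/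
theorem small_range {A : Type v} [CStarAlgebra A] (P : CovariantPair α A) :
    Small.{u} (StarAlgebra.adjoin ℂ (insert P.V (Set.range P.M))).topologicalClosure := by
  classical
  let g : (Option B) ⊕ (Option B) → A :=
    Sum.elim (fun o => o.elim P.V P.M) (fun o => star (o.elim P.V P.M))
  have hg : insert P.V (Set.range P.M) ∪ star (insert P.V (Set.range P.M)) = Set.range g := by
    ext x
    simp only [Set.mem_union, Set.mem_insert_iff, Set.mem_range, Set.mem_star, Sum.exists,
      Option.exists, g, Sum.elim_inl, Sum.elim_inr, Option.elim_none, Option.elim_some,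
      eq_comm]
    simp only [eq_star_iff_eq_star, eq_comm]
  let ev : (ℕ → FreeAlgebra ℂ ((Option B) ⊕ (Option B))) → A := fun w =>
    if h : ∃ a, Filter.Tendsto (fun n => FreeAlgebra.lift ℂ g (w n)) Filter.atTop (𝓝 a)
      then h.choose else 0
  suffices hsub : ((StarAlgebra.adjoin ℂ (insert P.V (Set.range P.M))).topologicalClosure : Set A)
      ⊆ Set.range ev from small_subset hsub
  intro a ha
  obtain ⟨x, hx, hxa⟩ := mem_closure_iff_seq_limit.1 ha
  have hx' : ∀ n, ∃ y, FreeAlgebra.lift ℂ g y = x n := fun n => by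
    have h1 : x n ∈ (StarAlgebra.adjoin ℂ (insert P.V (Set.range P.M))).toSubalgebra := hx n
    rw [StarAlgebra.adjoin_toSubalgebra, hg, Algebra.adjoin_range_eq_range_freeAlgebra_lift] at h1
    exact h1
  choose y hy using hx'
  have h : ∃ a, Filter.Tendsto (fun n => FreeAlgebra.lift ℂ g (y n)) Filter.atTop (𝓝 a) :=
    ⟨a, by simpa only [hy] using hxa⟩
  refine ⟨y, ?_⟩
  simp only [ev, dif_pos h]
  refine tendsto_nhds_unique h.choose_spec ?_
  simpa only [hy] using hxa

variable {α} in
/-- Every covariant pair factors through a covariant system. -/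
theorem exists_system {A : Type v} [CStarAlgebra A] [Nontrivial A] (P : CovariantPair α A) :
    ∃ (i : CovariantSystem α) (ψ : i.carrier →⋆ₐ[ℂ] A),
      ψ i.pair.V = P.V ∧ ∀ b, ψ (i.pair.M b) = P.M b := by
  let D := (StarAlgebra.adjoin ℂ (insert P.V (Set.range P.M))).topologicalClosure
  let _ : CStarAlgebra D := StarSubalgebra.cstarAlgebra D
    (h_closed := StarSubalgebra.isClosed_topologicalClosure _)
  have : Small.{u} D := small_range α P
  have : Nontrivial D := ⟨0, 1, fun h => zero_ne_one (congrArg Subtype.val h)⟩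
  let _ := shrinkCStarAlgebra.{u} D
  have hV : P.V ∈ D := StarSubalgebra.le_topologicalClosure _
    (StarAlgebra.subset_adjoin ℂ _ (Set.mem_insert _ _))
  have hM : ∀ b, P.M b ∈ D := fun b => StarSubalgebra.le_topologicalClosure _
    (StarAlgebra.subset_adjoin ℂ _ (Set.mem_insert_of_mem _ ⟨b, rfl⟩))
  let e := Shrink.algEquiv.{u} ℂ D
  let f : D →⋆ₐ[ℂ] Shrink.{u} D :=
    { (e.symm : D →ₐ[ℂ] Shrink.{u} D) with
      map_star' := fun x => by
        change e.symm (star x) = e.symm (star (e (e.symm x)))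
        simp }
  let k : Shrink.{u} D →⋆ₐ[ℂ] D :=
    { (e : Shrink.{u} D →ₐ[ℂ] D) with
      map_star' := fun x => by
        change e (e.symm (star (e x))) = star (e x)
        simp }
  have hkf : ∀ x, k (f x) = x := fun x => e.apply_symm_apply x
  let P' : CovariantPair α (Shrink.{u} D) :=
    { M := f.comp (P.M.codRestrict D hM)
      V := f ⟨P.V, hV⟩
      star_mul_self := by
        rw [← map_star, ← map_mul, ← map_one f]
        exact congrArg f (Subtype.ext P.star_mul_self)
      covariant := fun b => by
        rw [← map_star]
        change f _ * f _ * f _ = f _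
        rw [← map_mul, ← map_mul]
        exact congrArg f (Subtype.ext (P.covariant b)) }
  have : Nontrivial (Shrink.{u} D) := e.toEquiv.nontrivial
  refine ⟨⟨Shrink.{u} D, P'⟩, D.subtype.comp k, ?_, fun b => ?_⟩
  · change ((k (f ⟨P.V, hV⟩) : D) : A) = P.V
    rw [hkf]
  · change ((k (f ⟨P.M b, hM b⟩) : D) : A) = P.M b
    rw [hkf]

variable {α} in
/-- The universal property of the crossed product, for C⋆-algebras in every universe. -/
theorem existsUnique_lift {A : Type v} [CStarAlgebra A] (P : CovariantPair α A) :
    ∃! φ : CrossedProduct α →⋆ₐ[ℂ] A,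
      φ (universalPair α).V = P.V ∧ ∀ b, φ ((universalPair α).M b) = P.M b := by
  refine existsUnique_of_exists_of_unique ?_ ?_
  · rcases subsingleton_or_nontrivial A with hA | hA
    · exact ⟨{ toFun := fun _ => 0
               map_one' := Subsingleton.elim _ _
               map_mul' := fun _ _ => Subsingleton.elim _ _
               map_zero' := rfl
               map_add' := fun _ _ => Subsingleton.elim _ _
               commutes' := fun _ => Subsingleton.elim _ _
               map_star' := fun _ => Subsingleton.elim _ _ },
        Subsingleton.elim _ _, fun _ => Subsingleton.elim _ _⟩
    · obtain ⟨i, ψ, hV, hM⟩ := exists_system P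
      exact ⟨ψ.comp (proj α i), hV, hM⟩
  · rintro φ φ' ⟨hV, hM⟩ ⟨hV', hM'⟩
    have hc : Continuous φ :=
      AddMonoidHomClass.continuous_of_bound φ 1 fun x => by
        simpa only [one_mul] using NonUnitalStarAlgHom.norm_apply_le φ x
    have hc' : Continuous φ' :=
      AddMonoidHomClass.continuous_of_bound φ' 1 fun x => by
        simpa only [one_mul] using NonUnitalStarAlgHom.norm_apply_le φ' x
    refine StarAlgHom.ext_topologicalClosure (R := ℂ) (A := Ambient α) (B := A) hc hc' ?_
    refine StarAlgHom.ext_adjoin ?_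
    rintro ⟨x, hx⟩ hx'
    rcases hx' with rfl | ⟨b, rfl⟩
    · exact hV.trans hV'.symm
    · exact (hM b).trans (hM' b).symm

end CrossedProduct

/-! ### Endomorphisms given by multiplication -/

section Mul

variable {R : Type*} [CommRing R] [TopologicalSpace R] [CompactSpace R] [T2Space R]

/-- For an element `r` of a compact ring such that `x ↦ r x` is injective, continuous and open, the
endomorphism `α_r` of `C(R)` with `(α_r f)(x) = f (x / r)` if `r ∣ x`, and `0` otherwise
(`h.choose` is the unique `y` with `x = r y`). -/
def divEndomorphism (r : R) (hr : Topology.IsOpenEmbedding (fun x : R => r * x)) :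
    C(R, ℂ) →⋆ₙₐ[ℂ] C(R, ℂ) := by
  classical
  exact
  { toFun := fun f =>
      { toFun := fun x => if h : r ∣ x then f h.choose else 0
        continuous_toFun := by
          rw [continuous_iff_continuousAt]
          intro x
          by_cases hx : r ∣ x
          · obtain ⟨y, rfl⟩ := hx
            rw [← hr.continuousAt_iff (f := fun x : R => r * x)]
            have : ((fun x => if h : r ∣ x then f h.choose else 0) ∘ fun x : R => r * x) = f := by
              funext z
              have hz : r ∣ r * z := dvd_mul_right r z
              simp only [Function.comp_apply, dif_pos hz]
              exact congrArg f (hr.injective hz.choose_spec.symm)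
            rw [this]
            exact f.continuous.continuousAt
          · have hcl : IsClosed (Set.range fun x : R => r * x) :=
              (isCompact_range hr.continuous).isClosed
            have hmem : (Set.range fun x : R => r * x)ᶜ ∈ 𝓝 x :=
              hcl.isOpen_compl.mem_nhds fun ⟨y, hy⟩ => hx ⟨y, hy.symm⟩
            refine ContinuousAt.congr (f := fun _ => (0 : ℂ)) continuousAt_const ?_
            filter_upwards [hmem] with z hz
            rw [dif_neg]
            rintro ⟨y, rfl⟩
            exact hz ⟨y, rfl⟩ }
    map_smul' := fun c f => by ext x; by_cases h : r ∣ x <;> simp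
    map_zero' := by ext x; by_cases h : r ∣ x <;> simp
    map_add' := fun f g => by ext x; by_cases h : r ∣ x <;> simp [h]
    map_mul' := fun f g => by ext x; by_cases h : r ∣ x <;> simp [h]
    map_star' := fun f => by ext x; by_cases h : r ∣ x <;> simp [h] }

end Mul

/-! ### `A_r` -/

theorem padicInt_isOpenEmbedding_mul {p : ℕ} [Fact p.Prime] (r : ℤ_[p]) (hr : r ≠ 0) :
    Topology.IsOpenEmbedding (fun x : ℤ_[p] => r * x) := by
  have hc : Continuous (fun x : ℤ_[p] => r * x) := continuous_const.mul continuous_id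
  refine ⟨(hc.isClosedEmbedding (mul_right_injective₀ hr)).isEmbedding, ?_⟩
  have : (Set.range fun x : ℤ_[p] => r * x) = Metric.closedBall 0 ‖r‖ := by
    ext y
    rw [mem_closedBall_zero_iff]
    constructor
    · rintro ⟨x, rfl⟩
      rw [norm_mul]
      exact mul_le_of_le_one_right (norm_nonneg r) (PadicInt.norm_le_one x)
    · intro hy
      have hr' : (r : ℚ_[p]) ≠ 0 := by simpa using hr
      have hq : ‖(y : ℚ_[p]) / r‖ ≤ 1 := by
        rw [norm_div]
        exact div_le_one_of_le₀ hy (norm_nonneg _)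
      refine ⟨⟨(y : ℚ_[p]) / r, hq⟩, ?_⟩
      apply Subtype.ext
      change (r : ℚ_[p]) * (y / r) = y
      field_simp
  rw [this]
  exact IsUltrametricDist.isOpen_closedBall 0 (norm_ne_zero_iff.2 hr)

/-- The crossed product `A_r = C(ℤ_p) ⋊_{α_r} ℕ`, for a nonzero `p`-adic integer `r`. -/
abbrev PadicMulAlgebra {p : ℕ} [Fact p.Prime] (r : ℤ_[p]) (hr : r ≠ 0) : Type 1 :=
  CrossedProduct (divEndomorphism r (padicInt_isOpenEmbedding_mul r hr))

/-! ### The Hensel–Steinitz algebras -/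

/-- The ring `ℤ_s`, the inverse limit of the rings `ℤ / s ^ n`, with the inverse limit topology
(induced by the product of the discrete topologies). -/
def SadicInt (s : ℕ) : Subring (∀ n : ℕ, ZMod (s ^ n)) where
  carrier := {x | ∀ (m n : ℕ) (h : m ≤ n),
    ZMod.castHom (pow_dvd_pow s h) (ZMod (s ^ m)) (x n) = x m}
  zero_mem' := fun m n h => map_zero _
  one_mem' := fun m n h => map_one _
  add_mem' := fun {x y} hx hy m n h => by
    rw [Pi.add_apply, map_add, hx m n h, hy m n h, Pi.add_apply]
  mul_mem' := fun {x y} hx hy m n h => by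
    rw [Pi.mul_apply, map_mul, hx m n h, hy m n h, Pi.mul_apply]
  neg_mem' := fun {x} hx m n h => by rw [Pi.neg_apply, map_neg, hx m n h, Pi.neg_apply]

instance (s : ℕ) [NeZero s] : CompactSpace (SadicInt s) := by
  refine isCompact_iff_compactSpace.1 ?_
  refine IsClosed.isCompact ?_
  have : (SadicInt s : Set (∀ n : ℕ, ZMod (s ^ n))) = ⋂ (m : ℕ) (n : ℕ) (h : m ≤ n),
      {x | ZMod.castHom (pow_dvd_pow s h) (ZMod (s ^ m)) (x n) = x m} := by
    ext x
    simp only [Set.mem_iInter]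
    rfl
  rw [this]
  refine isClosed_iInter fun m => isClosed_iInter fun n => isClosed_iInter fun h => ?_
  exact isClosed_eq (continuous_of_discreteTopology.comp (continuous_apply n)) (continuous_apply m)

theorem sadicInt_isOpenEmbedding_mul (s : ℕ) [NeZero s] :
    Topology.IsOpenEmbedding (fun x : SadicInt s => (s : SadicInt s) * x) := by
  have hc : Continuous (fun x : SadicInt s => (s : SadicInt s) * x) :=
    continuous_const.mul continuous_id
  have key : ∀ (n : ℕ) (a b : ℕ), (s : ZMod (s ^ (n + 1))) * (a : ZMod (s ^ (n + 1))) = s * b ↔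
      (a : ZMod (s ^ n)) = b := fun n a b => by
    rw [← Nat.cast_mul, ← Nat.cast_mul, ZMod.natCast_eq_natCast_iff, ZMod.natCast_eq_natCast_iff,
      pow_succ']
    exact Nat.ModEq.mul_left_cancel_iff' (NeZero.ne s)
  have hcoe : ∀ (x : SadicInt s) (n : ℕ), (x.1 n : ZMod (s ^ n)) = ((x.1 (n + 1)).val : ℕ) :=
    fun x n => by
      rw [← x.2 n (n + 1) n.le_succ, ZMod.castHom_apply, ZMod.natCast_val]
  have hinj : Function.Injective (fun x : SadicInt s => (s : SadicInt s) * x) := by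
    intro x y hxy
    apply Subtype.ext
    funext n
    have h1 : (s : ZMod (s ^ (n + 1))) * x.1 (n + 1) = s * y.1 (n + 1) :=
      congrFun (congrArg Subtype.val hxy) (n + 1)
    rw [hcoe x n, hcoe y n, ← key]
    simpa only [ZMod.natCast_val, ZMod.cast_id', id] using h1
  refine ⟨(hc.isClosedEmbedding hinj).isEmbedding, ?_⟩
  have : (Set.range fun x : SadicInt s => (s : SadicInt s) * x) =
      (fun x : SadicInt s => x.1 1) ⁻¹' {0} := by
    ext x
    constructor
    · rintro ⟨y, rfl⟩
      have h1 : (s : ZMod (s ^ 1)) = 0 := by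
        rw [ZMod.natCast_eq_zero_iff]
        simp
      change (s : ZMod (s ^ 1)) * y.1 1 = 0
      rw [h1, zero_mul]
    · intro hx
      have hd : ∀ n, ∃ a : ℕ, (x.1 (n + 1)).val = s * a := fun n => by
        have h1 := x.2 1 (n + 1) (Nat.le_add_left 1 n)
        rw [show x.1 1 = 0 from hx, ZMod.castHom_apply, ← ZMod.natCast_val,
          ZMod.natCast_eq_zero_iff, pow_one] at h1
        exact h1
      choose a ha using hd
      have hxa : ∀ n, x.1 (n + 1) = (s : ZMod (s ^ (n + 1))) * (a n : ZMod (s ^ (n + 1))) :=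
        fun n => by
          rw [← Nat.cast_mul, ← ha n, ZMod.natCast_val, ZMod.cast_id', id]
      refine ⟨⟨fun n => (a n : ZMod (s ^ n)), fun m n h => ?_⟩, ?_⟩
      · rw [map_natCast, ← key]
        have h1 := x.2 (m + 1) (n + 1) (Nat.succ_le_succ h)
        rw [hxa n, hxa m, map_mul, map_natCast, map_natCast] at h1
        exact h1
      · apply Subtype.ext
        funext n
        change (s : ZMod (s ^ n)) * (a n : ZMod (s ^ n)) = x.1 n
        have h1 := x.2 n (n + 1) n.le_succ
        rw [hxa n, map_mul, map_natCast, map_natCast] at h1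
        exact h1
  rw [this]
  exact (isOpen_discrete _).preimage ((continuous_apply 1).comp continuous_subtype_val)

/-- The Hensel–Steinitz algebra `HS(s) = C(ℤ_s) ⋊_{α_s} ℕ`. -/
abbrev HenselSteinitz (s : ℕ) [NeZero s] : Type 1 :=
  CrossedProduct (divEndomorphism (s : SadicInt s) (sadicInt_isOpenEmbedding_mul s))

end

/-! The crossed product for multiplication by `r` sees the ring only through the space `R` and the
map `x ↦ r x`, so a homeomorphism conjugating two such maps gives an isomorphism
(`nonempty_starAlgEquiv_of_conj`). It need not be additive.

Write `r = u p^N` with `u` a unit. The twist `x ↦ u^(-k) x`, `k = ⌊v(x)/N⌋`, turns multiplication by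
`r` into multiplication by `p^N`: multiplying by `r` raises `k` by one, and the extra `u⁻¹` cancels
`u` (`padicTwist_inv_mul`). The twist is continuous because it preserves norms and is 1-Lipschitz
(`norm_padicTwist_sub_le`), and twisting by `u` inverts it.

Finally `ℤ_p` and `ℤ_{p^N}` are isomorphic as topological rings, since the powers of `p^N` are
cofinal among those of `p`; this map carries `p^N` to `p^N`. -/

noncomputable section

/-! ### Functoriality of the crossed product. -/

namespace CrossedProduct

/-- A ⋆-homomorphism intertwining two endomorphisms pulls covariant pairs back. -/
def _root_.CovariantPair.comap {B C : Type u} [CStarAlgebra B] [CStarAlgebra C]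
    {α : B →⋆ₙₐ[ℂ] B} {β : C →⋆ₙₐ[ℂ] C} {A : Type v} [CStarAlgebra A] (P : CovariantPair β A)
    (f : B →⋆ₐ[ℂ] C) (hf : ∀ b, f (α b) = β (f b)) : CovariantPair α A where
  M := P.M.comp f
  V := P.V
  star_mul_self := P.star_mul_self
  covariant b := by
    simp only [StarAlgHom.comp_apply, hf]
    exact P.covariant (f b)

/-- A ⋆-homomorphism that fixes the generators of the crossed product is the identity. -/
theorem hom_eq_id {B : Type u} [CStarAlgebra B] {α : B →⋆ₙₐ[ℂ] B}
    (φ : CrossedProduct α →⋆ₐ[ℂ] CrossedProduct α)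
    (hV : φ (universalPair α).V = (universalPair α).V)
    (hM : ∀ b, φ ((universalPair α).M b) = (universalPair α).M b) :
    φ = StarAlgHom.id ℂ (CrossedProduct α) :=
  (existsUnique_lift (universalPair α)).unique ⟨hV, hM⟩ ⟨rfl, fun _ => rfl⟩

/-- Conjugate endomorphisms have isomorphic crossed products. -/
theorem nonempty_starAlgEquiv {B C : Type u} [CStarAlgebra B] [CStarAlgebra C]
    {α : B →⋆ₙₐ[ℂ] B} {β : C →⋆ₙₐ[ℂ] C} (e : B ≃⋆ₐ[ℂ] C) (he : ∀ b, e (α b) = β (e b)) :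
    Nonempty (CrossedProduct α ≃⋆ₐ[ℂ] CrossedProduct β) := by
  have he' : ∀ c, e.symm (β c) = α (e.symm c) := fun c => by
    rw [← e.symm_apply_apply (α (e.symm c)), he, e.apply_symm_apply]
  -- Existence in the universal property gives maps both ways; uniqueness, through `hom_eq_id`,
  -- makes them mutually inverse.
  obtain ⟨φ, ⟨hφV, hφM⟩, -⟩ :=
    existsUnique_lift ((universalPair β).comap (α := α) (e : B →⋆ₐ[ℂ] C) he)
  obtain ⟨ψ, ⟨hψV, hψM⟩, -⟩ :=
    existsUnique_lift ((universalPair α).comap (α := β) (e.symm : C →⋆ₐ[ℂ] B) he')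
  replace hφM : ∀ b, φ ((universalPair α).M b) = (universalPair β).M (e b) := hφM
  replace hψM : ∀ c, ψ ((universalPair β).M c) = (universalPair α).M (e.symm c) := hψM
  replace hφV : φ (universalPair α).V = (universalPair β).V := hφV
  replace hψV : ψ (universalPair β).V = (universalPair α).V := hψV
  refine ⟨StarAlgEquiv.ofStarAlgHom φ ψ (hom_eq_id _ ?_ fun b => ?_)
    (hom_eq_id _ ?_ fun b => ?_)⟩
  · rw [StarAlgHom.comp_apply, hφV, hψV]
  · rw [StarAlgHom.comp_apply, hφM, hψM, e.symm_apply_apply]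
  · rw [StarAlgHom.comp_apply, hψV, hφV]
  · rw [StarAlgHom.comp_apply, hψM, hφM, e.apply_symm_apply]

end CrossedProduct

/-! ### Conjugate multiplication maps. -/

section DivEndomorphism

variable {R : Type*} [CommRing R] [TopologicalSpace R] [CompactSpace R] [T2Space R]

theorem divEndomorphism_apply_mul (r : R) (hr : Topology.IsOpenEmbedding (fun x : R => r * x))
    (f : C(R, ℂ)) (x : R) : divEndomorphism r hr f (r * x) = f x := by
  classical
  have h : r ∣ r * x := dvd_mul_right r x
  change (if h : r ∣ r * x then f h.choose else 0) = f x
  rw [dif_pos h]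
  exact congrArg f (hr.injective h.choose_spec.symm)

theorem divEndomorphism_apply_of_not_dvd (r : R)
    (hr : Topology.IsOpenEmbedding (fun x : R => r * x)) (f : C(R, ℂ)) {x : R} (hx : ¬ r ∣ x) :
    divEndomorphism r hr f x = 0 :=
  dif_neg hx

/-- A homeomorphism conjugating multiplication by `r` to multiplication by `s` induces an
isomorphism of crossed products. -/
theorem nonempty_starAlgEquiv_of_conj {R S : Type u}
    [CommRing R] [TopologicalSpace R] [CompactSpace R] [T2Space R]
    [CommRing S] [TopologicalSpace S] [CompactSpace S] [T2Space S]
    {r : R} (hr : Topology.IsOpenEmbedding (fun x : R => r * x))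
    {s : S} (hs : Topology.IsOpenEmbedding (fun x : S => s * x))
    (φ : R ≃ₜ S) (hφ : ∀ x, φ (r * x) = s * φ x) :
    Nonempty (CrossedProduct (divEndomorphism r hr) ≃⋆ₐ[ℂ]
      CrossedProduct (divEndomorphism s hs)) := by
  refine CrossedProduct.nonempty_starAlgEquiv (φ.symm.compStarAlgEquiv' ℂ ℂ) fun f => ?_
  ext y
  change divEndomorphism r hr f (φ.symm y) = _
  -- Since `φ` is onto and intertwines the multiplications, `s ∣ y` exactly when `r ∣ φ.symm y`; the
  -- two case distinctions therefore agree.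
  by_cases hy : s ∣ y
  · obtain ⟨z, rfl⟩ := hy
    have : φ.symm (s * z) = r * φ.symm z := by
      rw [φ.symm_apply_eq, hφ, φ.apply_symm_apply]
    rw [this, divEndomorphism_apply_mul, divEndomorphism_apply_mul]
    rfl
  · rw [divEndomorphism_apply_of_not_dvd _ _ _ hy, divEndomorphism_apply_of_not_dvd]
    rintro ⟨w, hw⟩
    exact hy ⟨φ w, by rw [← hφ, ← hw, φ.apply_symm_apply]⟩

end DivEndomorphism

/-! ### Removing the unit factor of `r`. -/

section PadicTwist

variable {p : ℕ} [Fact p.Prime]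

/-- The map `x ↦ u ^ k x` of `ℤ_p`, where `k` is the integer part of `v(x) / N`. -/
def padicTwist (N : ℕ) (u : ℤ_[p]ˣ) (x : ℤ_[p]) : ℤ_[p] :=
  ((u ^ (x.valuation / N) : ℤ_[p]ˣ) : ℤ_[p]) * x

theorem norm_padicTwist (N : ℕ) (u : ℤ_[p]ˣ) (x : ℤ_[p]) : ‖padicTwist N u x‖ = ‖x‖ := by
  rw [padicTwist, norm_mul, PadicInt.norm_units, one_mul]

theorem PadicInt.valuation_eq_of_norm_eq {x y : ℤ_[p]} (h : ‖x‖ = ‖y‖) :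
    x.valuation = y.valuation := by
  rcases eq_or_ne x 0 with rfl | hx
  · rw [norm_zero, eq_comm, norm_eq_zero] at h
    rw [h]
  · have hy : y ≠ 0 := by
      rw [← norm_ne_zero_iff, ← h]
      exact norm_ne_zero_iff.2 hx
    rw [PadicInt.norm_eq_zpow_neg_valuation hx, PadicInt.norm_eq_zpow_neg_valuation hy] at h
    have hp : (1 : ℝ) < p := by exact_mod_cast (Fact.out : p.Prime).one_lt
    have := zpow_right_injective₀ (zero_lt_one.trans hp) hp.ne' h
    omega

/-- If the norms agree, both points are multiplied by the same unit. Otherwise `‖x - y‖` is the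
larger of the two norms, which bounds the left side because the twist preserves norms. -/
theorem norm_padicTwist_sub_le (N : ℕ) (u : ℤ_[p]ˣ) (x y : ℤ_[p]) :
    ‖padicTwist N u x - padicTwist N u y‖ ≤ ‖x - y‖ := by
  by_cases h : ‖x‖ = ‖y‖
  · rw [padicTwist, padicTwist, PadicInt.valuation_eq_of_norm_eq h, ← mul_sub, norm_mul,
      PadicInt.norm_units, one_mul]
  · rw [sub_eq_add_neg x, PadicInt.norm_add_eq_max_of_ne (by rwa [norm_neg]), norm_neg,
      sub_eq_add_neg]
    refine (PadicInt.nonarchimedean _ _).trans ?_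
    rw [norm_neg, norm_padicTwist, norm_padicTwist]

theorem continuous_padicTwist (N : ℕ) (u : ℤ_[p]ˣ) : Continuous (padicTwist N u) :=
  (LipschitzWith.of_dist_le_mul (K := 1) fun x y => by
    simpa only [dist_eq_norm, NNReal.coe_one, one_mul] using
      norm_padicTwist_sub_le N u x y).continuous

theorem padicTwist_inv_padicTwist (N : ℕ) (u : ℤ_[p]ˣ) (x : ℤ_[p]) :
    padicTwist N u⁻¹ (padicTwist N u x) = x := by
  -- The twist preserves the valuation, so both twists use the same exponent and the units cancel.
  rw [padicTwist, PadicInt.valuation_eq_of_norm_eq (norm_padicTwist N u x), padicTwist,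
    ← mul_assoc, ← Units.val_mul, inv_pow, inv_mul_cancel, Units.val_one, one_mul]

/-- `padicTwist` as a homeomorphism. -/
def padicTwistHomeomorph (N : ℕ) (u : ℤ_[p]ˣ) : ℤ_[p] ≃ₜ ℤ_[p] where
  toFun := padicTwist N u
  invFun := padicTwist N u⁻¹
  left_inv := padicTwist_inv_padicTwist N u
  right_inv x := by simpa only [inv_inv] using padicTwist_inv_padicTwist N u⁻¹ x
  continuous_toFun := continuous_padicTwist N u
  continuous_invFun := continuous_padicTwist N u⁻¹

/-- The twist by `u⁻¹` conjugates multiplication by `u p ^ N` to multiplication by `p ^ N`. -/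
theorem padicTwist_inv_mul {N : ℕ} (hN : 0 < N) (u : ℤ_[p]ˣ) (x : ℤ_[p]) :
    padicTwist N u⁻¹ (u * (p : ℤ_[p]) ^ N * x) = (p : ℤ_[p]) ^ N * padicTwist N u⁻¹ x := by
  -- Zero is separate: its valuation is `0` by convention, so `hv` would fail there.
  rcases eq_or_ne x 0 with rfl | hx
  · simp [padicTwist]
  · have hv : ((u : ℤ_[p]) * (p : ℤ_[p]) ^ N * x).valuation = N + x.valuation := by
      rw [mul_assoc, ← PadicInt.valuation_p_pow_mul N x hx]
      exact PadicInt.valuation_eq_of_norm_eq (by rw [norm_mul, PadicInt.norm_units, one_mul])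
    rw [padicTwist, padicTwist, hv, Nat.add_div_left _ hN, pow_succ, Units.val_mul]
    linear_combination ((u⁻¹ ^ (x.valuation / N) : ℤ_[p]ˣ) : ℤ_[p]) * (p : ℤ_[p]) ^ N * x *
      u.inv_mul

end PadicTwist

/-! ### The homeomorphism between `ℤ_p` and `ℤ_{p^N}`. -/

section SadicInt

/-- There is at most one ring homomorphism from `ZMod c` to a given ring. -/
theorem ZMod.castHom_castHom {a b c : ℕ} (hab : a ∣ b) (hbc : b ∣ c) (x : ZMod c) :
    ZMod.castHom hab (ZMod a) (ZMod.castHom hbc (ZMod b) x) =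
      ZMod.castHom (hab.trans hbc) (ZMod a) x :=
  RingHom.congr_fun (Subsingleton.elim
    ((ZMod.castHom hab (ZMod a)).comp (ZMod.castHom hbc (ZMod b))) _) x

theorem pow_dvd_pow_pow (p : ℕ) {N : ℕ} (hN : 0 < N) (n : ℕ) : p ^ n ∣ (p ^ N) ^ n :=
  pow_dvd_pow_of_dvd (dvd_pow_self p hN.ne') n

/-- The kernel is the closed ball of radius `p^(-n)`, a neighbourhood of `0`, and for a homomorphism
continuity at `0` suffices. -/
theorem PadicInt.continuous_toZModPow {p : ℕ} [Fact p.Prime] (n : ℕ) :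
    Continuous (PadicInt.toZModPow n : ℤ_[p] →+* ZMod (p ^ n)) := by
  refine continuous_of_continuousAt_zero _ (ContinuousAt.congr continuousAt_const
    (f := fun _ => 0) ?_)
  have hp : (0 : ℝ) < p := by exact_mod_cast (Fact.out : p.Prime).pos
  filter_upwards [Metric.closedBall_mem_nhds (0 : ℤ_[p]) (zpow_pos hp (-(n : ℤ)))] with x hx
  rw [mem_closedBall_zero_iff, PadicInt.norm_le_pow_iff_mem_span_pow,
    ← PadicInt.ker_toZModPow] at hx
  exact hx.symm

variable (p : ℕ) (N : ℕ)

/-- The reduction `ℤ_p → ℤ / (p ^ N) ^ n`. -/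
def padicIntToZModPowPow [Fact p.Prime] (n : ℕ) : ℤ_[p] →+* ZMod ((p ^ N) ^ n) :=
  (ZMod.castHom (pow_mul p N n).symm.dvd (ZMod ((p ^ N) ^ n))).comp (PadicInt.toZModPow (N * n))

theorem continuous_padicIntToZModPowPow [Fact p.Prime] (n : ℕ) :
    Continuous (padicIntToZModPowPow p N n) :=
  (continuous_of_discreteTopology (f := ZMod.castHom (pow_mul p N n).symm.dvd _)).comp
    (PadicInt.continuous_toZModPow (N * n))

theorem castHom_padicIntToZModPowPow [Fact p.Prime] {m n : ℕ} (h : m ≤ n) (x : ℤ_[p]) :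
    ZMod.castHom (pow_dvd_pow (p ^ N) h) (ZMod ((p ^ N) ^ m)) (padicIntToZModPowPow p N n x) =
      padicIntToZModPowPow p N m x := by
  rw [padicIntToZModPowPow, padicIntToZModPowPow,
    ← PadicInt.zmod_cast_comp_toZModPow (N * m) (N * n) (Nat.mul_le_mul_left N h)]
  simp only [RingHom.comp_apply, ZMod.castHom_castHom]

/-- The canonical ring homomorphism `ℤ_p → ℤ_{p ^ N}`. -/
def padicIntToSadicInt [Fact p.Prime] : ℤ_[p] →+* SadicInt (p ^ N) :=
  (RingHom.pi (padicIntToZModPowPow p N)).codRestrict (SadicInt (p ^ N)) fun x _ _ h =>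
    castHom_padicIntToZModPowPow p N h x

theorem continuous_padicIntToSadicInt [Fact p.Prime] : Continuous (padicIntToSadicInt p N) :=
  (continuous_pi fun n => continuous_padicIntToZModPowPow p N n).subtype_mk _

variable {N}

/-- The reduction `ℤ_{p ^ N} → ℤ / p ^ n`. -/
def sadicIntToZModPow (hN : 0 < N) (n : ℕ) : SadicInt (p ^ N) →+* ZMod (p ^ n) :=
  (ZMod.castHom (pow_dvd_pow_pow p hN n) (ZMod (p ^ n))).comp
    ((Pi.evalRingHom (fun n => ZMod ((p ^ N) ^ n)) n).comp (SadicInt (p ^ N)).subtype)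

/-- This is the compatibility that `PadicInt.lift` requires to build a preimage in `ℤ_p`. -/
theorem castHom_comp_sadicIntToZModPow (hN : 0 < N) (m n : ℕ) (h : m ≤ n) :
    (ZMod.castHom (pow_dvd_pow p h) (ZMod (p ^ m))).comp (sadicIntToZModPow p hN n) =
      sadicIntToZModPow p hN m := by
  ext x
  change ZMod.castHom (pow_dvd_pow p h) _ (ZMod.castHom (pow_dvd_pow_pow p hN n) _ (x.1 n)) =
    ZMod.castHom (pow_dvd_pow_pow p hN m) _ (x.1 m)
  rw [← x.2 m n h, ZMod.castHom_castHom, ZMod.castHom_castHom]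

theorem sadicIntToZModPow_padicIntToSadicInt [Fact p.Prime] (hN : 0 < N) (n : ℕ)
    (x : ℤ_[p]) :
    sadicIntToZModPow p hN n (padicIntToSadicInt p N x) = PadicInt.toZModPow n x := by
  change ZMod.castHom (pow_dvd_pow_pow p hN n) _
    (ZMod.castHom (pow_mul p N n).symm.dvd _ (PadicInt.toZModPow (N * n) x)) = _
  rw [← PadicInt.zmod_cast_comp_toZModPow n (N * n) (Nat.le_mul_of_pos_left n hN),
    ZMod.castHom_castHom, RingHom.comp_apply]

theorem castHom_sadicIntToZModPow (hN : 0 < N) (n : ℕ) (x : SadicInt (p ^ N)) :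
    ZMod.castHom (pow_mul p N n).symm.dvd (ZMod ((p ^ N) ^ n))
      (sadicIntToZModPow p hN (N * n) x) = x.1 n := by
  rw [← x.2 n (N * n) (Nat.le_mul_of_pos_left n hN)]
  change ZMod.castHom _ _ (ZMod.castHom (pow_dvd_pow_pow p hN (N * n)) _ (x.1 (N * n))) = _
  rw [ZMod.castHom_castHom]

/-- Residues modulo all `p^n` determine a `p`-adic integer, whence injectivity. For surjectivity,
the lift of `x` has the residues of `x` modulo `p^(N n)`, and these are its coordinates. -/
theorem bijective_padicIntToSadicInt [Fact p.Prime] (hN : 0 < N) :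
    Function.Bijective (padicIntToSadicInt p N) := by
  refine ⟨fun x y hxy => PadicInt.ext_of_toZModPow.1 fun n => ?_, fun x => ?_⟩
  · rw [← sadicIntToZModPow_padicIntToSadicInt p hN, hxy, sadicIntToZModPow_padicIntToSadicInt]
  · refine ⟨PadicInt.lift (castHom_comp_sadicIntToZModPow p hN) x, Subtype.ext (funext fun n => ?_)⟩
    change ZMod.castHom (pow_mul p N n).symm.dvd _ (PadicInt.toZModPow (N * n)
      (PadicInt.lift (castHom_comp_sadicIntToZModPow p hN) x)) = x.1 n
    rw [← RingHom.comp_apply (PadicInt.toZModPow (N * n)), PadicInt.lift_spec,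
      castHom_sadicIntToZModPow]

/-- The canonical homeomorphism `ℤ_p ≃ ℤ_{p ^ N}`. -/
def padicIntHomeomorphSadicInt [Fact p.Prime] (hN : 0 < N) : ℤ_[p] ≃ₜ SadicInt (p ^ N) :=
  -- The inverse is continuous because the source is compact and the target Hausdorff.
  (continuous_padicIntToSadicInt p N).homeoOfEquivCompactToT2
    (f := Equiv.ofBijective _ (bijective_padicIntToSadicInt p hN))

end SadicInt

end

theorem mainTheorem2 (p : ℕ) [Fact p.Prime] (r : ℤ_[p]) (hr : r ≠ 0) (N : ℕ) (hN : 0 < N)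
    (hrN : ‖r‖ = (p : ℝ) ^ (-(N : ℤ))) :
    Nonempty (PadicMulAlgebra r hr ≃⋆ₐ[ℂ] HenselSteinitz (p ^ N)) := by
  have hv : r.valuation = N := by
    rw [PadicInt.norm_eq_zpow_neg_valuation hr] at hrN
    have hp : (1 : ℝ) < p := by exact_mod_cast (Fact.out : p.Prime).one_lt
    have := zpow_right_injective₀ (zero_lt_one.trans hp) hp.ne' hrN
    omega
  have hru : r = PadicInt.unitCoeff hr * (p : ℤ_[p]) ^ N := by
    conv_lhs => rw [PadicInt.unitCoeff_spec hr, hv]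
  -- The twist replaces `r` by `p^N` inside `ℤ_p`; the ring map then carries `p^N` to the generator
  -- of `HS(p^N)`'s endomorphism.
  refine nonempty_starAlgEquiv_of_conj _ _ ((padicTwistHomeomorph N (PadicInt.unitCoeff hr)⁻¹).trans
    (padicIntHomeomorphSadicInt p hN)) fun x => ?_
  change padicIntToSadicInt p N (padicTwist N _ (r * x)) =
    ((p ^ N : ℕ) : SadicInt (p ^ N)) * padicIntToSadicInt p N (padicTwist N _ x)
  have h := padicTwist_inv_mul hN (PadicInt.unitCoeff hr) x
  rw [← hru] at h
  rw [h, map_mul, map_pow, map_natCast, Nat.cast_pow]
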